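/- Fix $n \ge 0$. An ordered set partition $\Phi = \Phi_1|\cdots|\Phi_\ell$ of $[n]=\{1,\dots,n\}$ is a sequence of pairwise disjoint non-empty sets with union $[n]$; a vector $x$ has order type $\Phi$ if it is constant on each block and its values strictly increase from each block to the later ones. Let $\sigma_\Phi$ be the set of all $x\in(0,1)^n$ of order type $\Phi$; it is a relatively open simplex, and the $\sigma_\Phi$ are the faces of the triangulation of $(0,1)^n$ by the hyperplanes $x_i=x_j$. For a boolean formula $S$ over the atoms $x_i\le x_j$ ($i,j\in[n]$), let $\operatorname{Allow}(S)$ be the set of all faces $\sigma_\Phi$ such that every positive integer vector of order type $\Phi$ satisfies $S$. A half-open $d$-simplex is a $d$-dimensional simplex from which some (possibly none, possibly all) of its facets have been removed. A set $F$ of such faces is partitionable (in dimension $d$) if all its maximal faces have dimension $d$ and the union of the faces in $F$ is a disjoint union of half-open $d$-simplices, each having the closure of a face in $F$ as its underlying simplex. A decision tree is either a leaf, i.e. a finite conjunction of inequalities of the form $x_i\le x_j$ or $x_i<x_j$, or a formula "if $\varphi$ then $\psi_t$ else $\psi_f$" where $\varphi$ is an inequality $x_i\le x_j$ or $x_i<x_j$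 and $\psi_t,\psi_f$ are decision trees. The cell at a leaf $v$ is the set of all $x\in(0,1)^n$ satisfying the inequalities of the leaf and, for every ancestor of $v$, its condition $\varphi$ if $v$ lies in the then-branch and $\neg\varphi$ if $v$ lies in the else-branch. A set $P\subseteq\mathbb R^n$ is almost open if it is the solution set of a finite conjunction of linear inequalities (strict or weak), at most one of which is weak and each of which is facet-defining for $P$, i.e. its bounding hyperplane meets the closure of $P$ in a non-empty set of dimension $\dim P-1$. (In particular, the empty set is not almost open.) Corollary. (a) If $S$ is a decision tree all of whose cells are almost open, then $\operatorname{Allow}(S)$ is partitionable, in dimension $n$. (b) If $S_1,\dots,S_m$ are decision trees on the same $n$ variables, all of whose cells are almost open, such that every $x\in\mathbb R^n$ satisfies at most one of the $S_i$, then $\operatorname{Allow}(S_1\vee\dots\vee S_m)$ is partitionable, in dimension $n$. -/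

import Mathlib

namespace Scheduling

/-- Boolean formulas over the atoms `x_i ≤ x_j`, `i, j ∈ [n]`: scheduling problems on `n` items. -/
inductive Problem (n : ℕ) : Type
  | verum : Problem n
  | falsum : Problem n
  | atom (i j : Fin n) : Problem n
  | neg (S : Problem n) : Problem n
  | conj (S T : Problem n) : Problem n
  | disj (S T : Problem n) : Problem n

/-- Truth of a scheduling problem at an assignment `x` of the variables. -/
def Problem.Holds {n : ℕ} {α : Type} [LinearOrder α] : Problem n → (Fin n → α) → Prop
  | .verum, _ => True
  | .falsum, _ => False
  | .atom i j, x => x i ≤ x j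
  | .neg S, x => ¬ S.Holds x
  | .conj S T, x => S.Holds x ∧ T.Holds x
  | .disj S T, x => S.Holds x ∨ T.Holds x

/-- The conjunction of a finite list of problems. -/
def Problem.bigConj {n : ℕ} (L : List (Problem n)) : Problem n := L.foldr Problem.conj Problem.verum

/-- The disjunction of a finite list of problems. -/
def Problem.bigDisj {n : ℕ} (L : List (Problem n)) : Problem n := L.foldr Problem.disj Problem.falsum

/-- Ordered set partitions (set compositions) `Φ_1 | Φ_2 | ⋯ | Φ_ℓ` of `[n]`. -/
structure OrderedSetPartition (n : ℕ) where
  length : ℕ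
  block : Fin length → Finset (Fin n)
  block_nonempty : ∀ k, (block k).Nonempty
  block_disjoint : ∀ k l, k ≠ l → Disjoint (block k) (block l)
  block_cover : ∀ i, ∃ k, i ∈ block k

/-- `Δ(x) = Φ`: the vector `x` is constant on every block of `Φ`, and its values strictly increase
from each block to the later ones. -/
def OrderedSetPartition.IsOrderTypeOf {n : ℕ} {α : Type} [LinearOrder α]
    (Φ : OrderedSetPartition n) (x : Fin n → α) : Prop :=
  (∀ k, ∀ i ∈ Φ.block k, ∀ j ∈ Φ.block k, x i = x j) ∧
    ∀ k l, k < l → ∀ i ∈ Φ.block k, ∀ j ∈ Φ.block l, x i < x j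

/-- `Φ` solves `S`: every positive integer vector with relative order `Φ` solves `S`. -/
def OrderedSetPartition.Solves {n : ℕ} (Φ : OrderedSetPartition n) (S : Problem n) : Prop :=
  ∀ a : Fin n → ℕ, (∀ i, 0 < a i) → Φ.IsOrderTypeOf a → S.Holds a

/-- The open unit cube `(0,1)^n`. -/
def openCube (n : ℕ) : Set (Fin n → ℝ) := {x | ∀ i, 0 < x i ∧ x i < 1}

/-- The face `σ_Φ` of the braid triangulation of the open cube: a relatively open simplex. -/
def OrderedSetPartition.face {n : ℕ} (Φ : OrderedSetPartition n) : Set (Fin n → ℝ) :=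
  {x | x ∈ openCube n ∧ Φ.IsOrderTypeOf x}

/-- The allowed configuration: the set of all faces `σ_Φ` such that `Φ` solves `S`. -/
def allow {n : ℕ} (S : Problem n) : Set (Set (Fin n → ℝ)) :=
  {σ | ∃ Φ : OrderedSetPartition n, Φ.Solves S ∧ σ = Φ.face}

/-- The simplex with vertices `v`, from which the facets opposite to the vertices `v j`, `j ∈ J`,
are removed (`w j` is the barycentric coordinate of a point at `v j`). -/
def halfOpenSimplex {n d : ℕ} (v : Fin (d + 1) → Fin n → ℝ) (J : Set (Fin (d + 1))) :
    Set (Fin n → ℝ) :=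
  {x | ∃ w : Fin (d + 1) → ℝ, (∀ j, 0 ≤ w j) ∧ (∀ j ∈ J, 0 < w j) ∧ ∑ j, w j = 1 ∧
    x = ∑ j, w j • v j}

/-- The relatively open simplex with vertices `v`: all facets are removed. -/
def openSimplex {n d : ℕ} (v : Fin (d + 1) → Fin n → ℝ) : Set (Fin n → ℝ) :=
  halfOpenSimplex v Set.univ

/-- A set `F` of relatively open simplices is pure of dimension `d`: every face in `F` that is
maximal (for containment in the closure) is a `d`-dimensional simplex. -/
def IsPure {n : ℕ} (d : ℕ) (F : Set (Set (Fin n → ℝ))) : Prop :=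
  ∀ σ ∈ F, (∀ τ ∈ F, σ ⊆ closure τ → τ = σ) →
    ∃ v : Fin (d + 1) → Fin n → ℝ, AffineIndependent ℝ v ∧ σ = openSimplex v

/-- A set `F` of faces (relatively open simplices of a triangulation) is partitionable in
dimension `d`: it is pure of dimension `d`, and the union of its faces is a disjoint union of
half-open `d`-dimensional simplices, each of them a `d`-dimensional simplex of `F` together with
some of its faces. -/
def IsPartitionable {n : ℕ} (d : ℕ) (F : Set (Set (Fin n → ℝ))) : Prop :=
  IsPure d F ∧
    ∃ P : Set (Set (Fin n → ℝ)),
      (∀ H ∈ P, ∃ (v : Fin (d + 1) → Fin n → ℝ) (J : Set (Fin (d + 1))),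
        AffineIndependent ℝ v ∧ openSimplex v ∈ F ∧ H = halfOpenSimplex v J) ∧
      P.PairwiseDisjoint id ∧ ⋃₀ P = ⋃₀ F

/-- The inequalities `x_i ≤ x_j` and `x_i < x_j`. -/
inductive Ineq (n : ℕ) : Type
  | le (i j : Fin n) : Ineq n
  | lt (i j : Fin n) : Ineq n

/-- The inequality as a boolean formula over the atoms `x_i ≤ x_j`. -/
def Ineq.toProblem {n : ℕ} : Ineq n → Problem n
  | .le i j => .atom i j
  | .lt i j => .neg (.atom j i)

/-- The negated inequality. -/
def Ineq.negate {n : ℕ} : Ineq n → Ineq n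
  | .le i j => .lt j i
  | .lt i j => .le j i

/-- Truth of an inequality at a real vector. -/
def Ineq.Holds {n : ℕ} : Ineq n → (Fin n → ℝ) → Prop
  | .le i j, x => x i ≤ x j
  | .lt i j, x => x i < x j

/-- Decision trees: a leaf is a conjunction of inequalities, an inner node is
`if φ then t else f` for an inequality `φ` and two decision trees `t`, `f`. -/
inductive DecisionTree (n : ℕ) : Type
  | leaf (c : List (Ineq n)) : DecisionTree n
  | cond (φ : Ineq n) (t f : DecisionTree n) : DecisionTree n

/-- The boolean formula of a decision tree. -/
def DecisionTree.toProblem {n : ℕ} : DecisionTree n → Problem n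
  | .leaf c => .bigConj (c.map Ineq.toProblem)
  | .cond φ t f =>
      .disj (.conj φ.toProblem t.toProblem) (.conj (.neg φ.toProblem) f.toProblem)

/-- The cells of a decision tree, one for each leaf `v`: the inequalities at `v` together with the
conditions at the ancestors of `v`, negated when `v` lies in the else-branch. -/
def DecisionTree.cells {n : ℕ} : DecisionTree n → List (List (Ineq n))
  | .leaf c => [c]
  | .cond φ t f => t.cells.map (φ :: ·) ++ f.cells.map (φ.negate :: ·)

/-- The solution set in `(0,1)^n` of a conjunction of inequalities. -/
def cellPolytope {n : ℕ} (c : List (Ineq n)) : Set (Fin n → ℝ) :=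
  {x | x ∈ openCube n ∧ ∀ I ∈ c, I.Holds x}

/-- A linear inequality `∑ a_i x_i ≤ b` (weak) or `∑ a_i x_i < b` (strict). -/
structure LinIneq (n : ℕ) where
  coeff : Fin n → ℝ
  bound : ℝ
  weak : Prop

/-- Truth of a linear inequality at a real vector. -/
def LinIneq.Holds {n : ℕ} (I : LinIneq n) (x : Fin n → ℝ) : Prop :=
  (I.weak ∧ ∑ i, I.coeff i * x i ≤ I.bound) ∨ (¬ I.weak ∧ ∑ i, I.coeff i * x i < I.bound)

/-- The face of the closure of `P` on the bounding hyperplane of `I`. -/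
def LinIneq.faceOf {n : ℕ} (I : LinIneq n) (P : Set (Fin n → ℝ)) : Set (Fin n → ℝ) :=
  {x | x ∈ closure P ∧ ∑ i, I.coeff i * x i = I.bound}

/-- `I` is valid on `P` and cuts out a facet, that is, a face of dimension `dim P - 1`. -/
def LinIneq.IsFacetDefining {n : ℕ} (I : LinIneq n) (P : Set (Fin n → ℝ)) : Prop :=
  (∀ x ∈ P, I.Holds x) ∧ (I.faceOf P).Nonempty ∧
    Module.finrank ℝ (vectorSpan ℝ (I.faceOf P)) + 1 = Module.finrank ℝ (vectorSpan ℝ P)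

/-- `P` is almost open: it is the solution set of a finite conjunction of facet-defining linear
inequalities of which at most one is weak. -/
def IsAlmostOpen {n : ℕ} (P : Set (Fin n → ℝ)) : Prop :=
  ∃ (k : ℕ) (I : Fin k → LinIneq n),
    (∀ x, x ∈ P ↔ ∀ j, (I j).Holds x) ∧
    (∀ j, (I j).IsFacetDefining P) ∧
    ∀ j l, (I j).weak → (I l).weak → j = l

/-- All cells of the decision tree are almost open. -/
def DecisionTree.AllCellsAlmostOpen {n : ℕ} (S : DecisionTree n) : Prop :=
  ∀ c ∈ S.cells, IsAlmostOpen (cellPolytope c)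

end Scheduling

/-!
The union of the faces in `allow S` is the set of solutions of `S` in the open cube
(`sUnion_allow`), and for a decision tree this set is the disjoint union of the cells. So it is
enough to partition a single almost open cell `Q` into half-open simplices.

Fix a point `q` of the cube with distinct coordinates. For a point `x` of the cube, the points
`x + ε (x - q)` with small `ε > 0` all lie in the interior of one and the same maximal simplex of
the braid triangulation. The points `x` that belong in this way to a given simplex form the simplex
without the facets that have `q` on the inner side of their hyperplane. Hence these half-open
simplices partition the cube (`exists_mem_halfOpenChamber`, `halfOpenChamber_eq_of_mem`).

The cell `Q` is a union of some of them if small steps away from `q` neither leave nor enter `Q`.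
This holds if `q` satisfies all strict inequalities of `Q` and violates the weak one: then steps
away from `q` cross no strict facet inwards, and they lead from the weak facet into the interior.
Such a point exists close to any point of `Q` on the weak facet; if there is no point of `Q` on the
weak facet, then any generic point of `Q` will do (`IsAlmostOpen.exists_generic_point`). It is here
that at most one inequality may be weak.

For purity, the half-open simplex containing a point of a face `σ` of `allow S` contains all of `σ`,
since membership depends only on the order type; so `σ` lies in the closure of a maximal simplex
that also belongs to `allow S`.
-/

namespace Scheduling

open Filter Topology

/-! ### Truth of a formula depends only on the order type -/

lemma Problem.holds_congr {n : ℕ} {α β : Type} [LinearOrder α] [LinearOrder β]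
    {x : Fin n → α} {y : Fin n → β} (h : ∀ i j, x i ≤ x j ↔ y i ≤ y j) (S : Problem n) :
    S.Holds x ↔ S.Holds y := by
  induction S with
  | verum => exact Iff.rfl
  | falsum => exact Iff.rfl
  | atom i j => exact h i j
  | neg S ih => exact not_congr ih
  | conj S T ihS ihT => exact and_congr ihS ihT
  | disj S T ihS ihT => exact or_congr ihS ihT

lemma Problem.holds_bigConj {n : ℕ} {α : Type} [LinearOrder α] (L : List (Problem n))
    (x : Fin n → α) : (Problem.bigConj L).Holds x ↔ ∀ S ∈ L, S.Holds x := by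
  induction L with
  | nil => simp [Problem.bigConj, Problem.Holds]
  | cons S L ih =>
    rw [List.forall_mem_cons, ← ih]
    rfl

lemma Problem.holds_bigDisj {n : ℕ} {α : Type} [LinearOrder α] (L : List (Problem n))
    (x : Fin n → α) : (Problem.bigDisj L).Holds x ↔ ∃ S ∈ L, S.Holds x := by
  induction L with
  | nil => simp [Problem.bigDisj, Problem.Holds]
  | cons S L ih =>
    simp only [List.mem_cons, exists_eq_or_imp, ← ih]
    rfl

lemma Ineq.holds_toProblem {n : ℕ} (I : Ineq n) (x : Fin n → ℝ) :
    I.toProblem.Holds x ↔ I.Holds x := by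
  cases I <;> simp [Ineq.toProblem, Problem.Holds, Ineq.Holds]

lemma Ineq.holds_negate {n : ℕ} (I : Ineq n) (x : Fin n → ℝ) :
    I.negate.Holds x ↔ ¬ I.Holds x := by
  cases I <;> simp [Ineq.negate, Ineq.Holds]

lemma Ineq.holds_congr {n : ℕ} {x y : Fin n → ℝ} (h : ∀ i j, x i ≤ x j ↔ y i ≤ y j)
    (I : Ineq n) : I.Holds x ↔ I.Holds y := by
  rw [← I.holds_toProblem, ← I.holds_toProblem, Problem.holds_congr h]

lemma OrderedSetPartition.IsOrderTypeOf.le_iff_le {n : ℕ} {α β : Type} [LinearOrder α]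
    [LinearOrder β] {Φ : OrderedSetPartition n} {x : Fin n → α} {y : Fin n → β}
    (hx : Φ.IsOrderTypeOf x) (hy : Φ.IsOrderTypeOf y) (i j : Fin n) :
    x i ≤ x j ↔ y i ≤ y j := by
  obtain ⟨k, hk⟩ := Φ.block_cover i
  obtain ⟨l, hl⟩ := Φ.block_cover j
  rcases lt_trichotomy k l with h | rfl | h
  · exact iff_of_true (hx.2 k l h i hk j hl).le (hy.2 k l h i hk j hl).le
  · exact iff_of_true (hx.1 k i hk j hl).le (hy.1 k i hk j hl).le
  · exact iff_of_false (hx.2 l k h j hl i hk).not_ge (hy.2 l k h j hl i hk).not_ge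

lemma OrderedSetPartition.IsOrderTypeOf.of_le_iff_le {n : ℕ} {α β : Type} [LinearOrder α]
    [LinearOrder β] {Φ : OrderedSetPartition n} {x : Fin n → α} {y : Fin n → β}
    (hx : Φ.IsOrderTypeOf x) (h : ∀ i j, x i ≤ x j ↔ y i ≤ y j) : Φ.IsOrderTypeOf y := by
  refine ⟨fun k i hi j hj => ?_, fun k l hkl i hi j hj => ?_⟩
  · have := hx.1 k i hi j hj
    exact le_antisymm ((h i j).1 this.le) ((h j i).1 this.ge)
  · exact lt_of_not_ge fun hji => (hx.2 k l hkl i hi j hj).not_ge ((h j i).2 hji)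

/-- Every ordered set partition is the order type of a positive integer vector: number the
blocks from the left, starting with one. -/
lemma OrderedSetPartition.exists_nat {n : ℕ} (Φ : OrderedSetPartition n) :
    ∃ a : Fin n → ℕ, (∀ i, 0 < a i) ∧ (∀ i, a i ≤ Φ.length) ∧ Φ.IsOrderTypeOf a := by
  choose k hk using Φ.block_cover
  have hkey : ∀ l, ∀ i ∈ Φ.block l, k i = l := fun l i hi => by
    by_contra hne
    exact Finset.disjoint_left.1 (Φ.block_disjoint _ _ hne) (hk i) hi
  refine ⟨fun i => (k i : ℕ) + 1, fun i => Nat.succ_pos _, fun i => (k i).2, ?_, ?_⟩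
  · intro l i hi j hj
    simp only [hkey l i hi, hkey l j hj]
  · intro l m hlm i hi j hj
    simp only [hkey l i hi, hkey m j hj]
    exact Nat.succ_lt_succ hlm

lemma OrderedSetPartition.face_nonempty {n : ℕ} (Φ : OrderedSetPartition n) :
    Φ.face.Nonempty := by
  obtain ⟨a, ha, hal, hΦ⟩ := Φ.exists_nat
  have hpos : (0 : ℝ) < Φ.length + 1 := by positivity
  refine ⟨fun i => (a i : ℝ) / (Φ.length + 1), fun i => ⟨?_, ?_⟩, hΦ.of_le_iff_le fun i j => ?_⟩
  · exact div_pos (by exact_mod_cast ha i) hpos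
  · rw [div_lt_one hpos]
    exact_mod_cast Nat.lt_succ_of_le (hal i)
  · rw [div_le_div_iff_of_pos_right hpos, Nat.cast_le]

lemma exists_isOrderTypeOf {n : ℕ} (x : Fin n → ℝ) :
    ∃ Φ : OrderedSetPartition n, Φ.IsOrderTypeOf x := by
  classical
  let s : Finset ℝ := Finset.univ.image x
  let e := s.orderEmbOfFin rfl
  refine ⟨⟨s.card, fun k => {i | x i = e k}, fun k => ?_, fun k l hkl => ?_, fun i => ?_⟩, ?_, ?_⟩
  · obtain ⟨i, -, hi⟩ := Finset.mem_image.1 (s.orderEmbOfFin_mem rfl k)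
    exact ⟨i, by simpa using hi⟩
  · refine Finset.disjoint_left.2 fun i hi hi' => hkl (e.injective ?_)
    simp only [Finset.mem_filter, Finset.mem_univ, true_and] at hi hi'
    rw [← hi, ← hi']
  · have : x i ∈ Set.range e := by
      rw [Finset.range_orderEmbOfFin]
      simp [s]
    obtain ⟨k, hk⟩ := this
    exact ⟨k, by simpa using hk.symm⟩
  · intro k i hi j hj
    simp only [Finset.mem_filter, Finset.mem_univ, true_and] at hi hj
    rw [hi, hj]
  · intro k l hkl i hi j hj
    simp only [Finset.mem_filter, Finset.mem_univ, true_and] at hi hj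
    rw [hi, hj]
    exact e.strictMono hkl

lemma OrderedSetPartition.solves_iff {n : ℕ} {Φ : OrderedSetPartition n} {x : Fin n → ℝ}
    (hx : Φ.IsOrderTypeOf x) (S : Problem n) : Φ.Solves S ↔ S.Holds x := by
  refine ⟨fun h => ?_, fun h a _ ha => (Problem.holds_congr (ha.le_iff_le hx) S).2 h⟩
  obtain ⟨a, ha, -, haΦ⟩ := Φ.exists_nat
  exact (Problem.holds_congr (haΦ.le_iff_le hx) S).1 (h a ha haΦ)

lemma sUnion_allow {n : ℕ} (S : Problem n) :
    ⋃₀ allow S = {x | x ∈ openCube n ∧ S.Holds x} := by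
  ext x
  constructor
  · rintro ⟨_, ⟨Φ, hΦ, rfl⟩, hx⟩
    exact ⟨hx.1, (Φ.solves_iff hx.2 S).1 hΦ⟩
  · rintro ⟨hx, hS⟩
    obtain ⟨Φ, hΦ⟩ := exists_isOrderTypeOf x
    exact ⟨Φ.face, ⟨Φ, (Φ.solves_iff hΦ S).2 hS, rfl⟩, hx, hΦ⟩

/-! ### Chambers of the braid arrangement in the cube -/

/-- The values of `x` in the order prescribed by `π`, preceded by `0` and followed by `1`:
`0, x (π 0), …, x (π (n - 1)), 1, 1, …`. -/
noncomputable def sortedValue {n : ℕ} (π : Equiv.Perm (Fin n)) (x : Fin n → ℝ) (k : ℕ) : ℝ :=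
  if k = 0 then 0 else if h : k - 1 < n then x (π ⟨k - 1, h⟩) else 1

/-- The differences of consecutive terms of `0, x (π 0), …, x (π (n - 1)), 1`. They are the
barycentric coordinates of `x` in the simplex `0 ≤ x (π 0) ≤ ⋯ ≤ x (π (n - 1)) ≤ 1`. -/
noncomputable def gap {n : ℕ} (π : Equiv.Perm (Fin n)) (x : Fin n → ℝ) (j : Fin (n + 1)) : ℝ :=
  sortedValue π x (j + 1) - sortedValue π x j

/-- The open simplex `0 < x (π 0) < ⋯ < x (π (n - 1)) < 1`. -/
def chamber {n : ℕ} (π : Equiv.Perm (Fin n)) : Set (Fin n → ℝ) :=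
  {x | ∀ j, 0 < gap π x j}

/-- The closed simplex `0 ≤ x (π 0) ≤ ⋯ ≤ x (π (n - 1)) ≤ 1` without the facets whose hyperplane
does not separate the simplex from `q`. -/
def halfOpenChamber {n : ℕ} (π : Equiv.Perm (Fin n)) (q : Fin n → ℝ) : Set (Fin n → ℝ) :=
  {x | ∀ j, 0 ≤ gap π x j ∧ (0 < gap π q j → 0 < gap π x j)}

/-- The vertex of the simplex `0 ≤ x (π 0) ≤ ⋯ ≤ x (π (n - 1)) ≤ 1` at which only the `j`-th of
these inequalities is strict. -/
noncomputable def vertex {n : ℕ} (π : Equiv.Perm (Fin n)) (j : Fin (n + 1)) : Fin n → ℝ :=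
  fun i => if (j : ℕ) ≤ π.symm i then 1 else 0

section Chambers

variable {n : ℕ} (π : Equiv.Perm (Fin n))

lemma sortedValue_zero (x : Fin n → ℝ) : sortedValue π x 0 = 0 := by
  simp [sortedValue]

lemma sortedValue_succ (x : Fin n → ℝ) (i : Fin n) : sortedValue π x (i + 1) = x (π i) := by
  simp [sortedValue]

lemma sortedValue_last (x : Fin n → ℝ) : sortedValue π x (n + 1) = 1 := by
  simp [sortedValue]

/-- The first `k` weights of a convex combination of the vertices add up to the `k`-th value. -/
lemma sum_ite_lt_eq_sortedValue {w : Fin (n + 1) → ℝ} (hw : ∑ j, w j = 1) {k : ℕ}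
    (hk : k ≤ n + 1) :
    ∑ j : Fin (n + 1), (if (j : ℕ) < k then w j else 0) =
      sortedValue π (∑ j, w j • vertex π j) k := by
  rcases k with _ | k
  · simp [sortedValue]
  rcases Nat.lt_or_ge k n with hkn | hkn
  · rw [show k + 1 = ((⟨k, hkn⟩ : Fin n) : ℕ) + 1 from rfl, sortedValue_succ]
    simp [vertex]
  · obtain rfl : k = n := by omega
    simp only [Fin.is_lt, if_true, sortedValue_last, hw]

lemma sum_ite_lt_succ_sub (w : Fin (n + 1) → ℝ) (j : Fin (n + 1)) :
    ∑ l : Fin (n + 1), (if (l : ℕ) < j + 1 then w l else 0) -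
      ∑ l : Fin (n + 1), (if (l : ℕ) < j then w l else 0) = w j := by
  rw [← Finset.sum_sub_distrib, Finset.sum_eq_single j]
  · simp
  · intro l _ hl
    have : (l : ℕ) ≠ j := fun h => hl (Fin.ext h)
    have : (l : ℕ) < j + 1 ↔ (l : ℕ) < j := by omega
    simp [this]
  · simp

lemma gap_sum_smul_vertex {w : Fin (n + 1) → ℝ} (hw : ∑ j, w j = 1) (j : Fin (n + 1)) :
    gap π (∑ j, w j • vertex π j) j = w j := by
  rw [gap, ← sum_ite_lt_eq_sortedValue π hw (by omega), ← sum_ite_lt_eq_sortedValue π hw (by omega),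
    sum_ite_lt_succ_sub]

lemma sum_ite_lt_gap (x : Fin n → ℝ) {k : ℕ} (hk : k ≤ n + 1) :
    ∑ j : Fin (n + 1), (if (j : ℕ) < k then gap π x j else 0) = sortedValue π x k := by
  let g : ℕ → ℝ := fun j => sortedValue π x (j + 1) - sortedValue π x j
  have h1 := Fin.sum_univ_eq_sum_range (fun j => if j < k then g j else 0) (n + 1)
  have h2 : (Finset.range (n + 1)).filter (fun j => j < k) = Finset.range k := by
    ext j
    simp only [Finset.mem_filter, Finset.mem_range]
    omega
  rw [← Finset.sum_filter (s := Finset.range (n + 1)), h2, Finset.sum_range_sub,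
    sortedValue_zero, sub_zero] at h1
  exact h1

lemma sum_gap (x : Fin n → ℝ) : ∑ j, gap π x j = 1 := by
  have := sum_ite_lt_gap π x le_rfl
  simpa only [sortedValue_last, Fin.is_lt, if_true] using this

lemma sum_gap_smul_vertex (x : Fin n → ℝ) : ∑ j, gap π x j • vertex π j = x := by
  ext i
  obtain ⟨i, rfl⟩ := π.surjective i
  rw [← sortedValue_succ π x, ← sum_ite_lt_gap π x (by omega),
    sum_ite_lt_eq_sortedValue π (sum_gap π x) (by omega), sortedValue_succ]

lemma halfOpenSimplex_vertex (J : Set (Fin (n + 1))) :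
    halfOpenSimplex (vertex π) J = {x | ∀ j, 0 ≤ gap π x j ∧ (j ∈ J → 0 < gap π x j)} := by
  ext x
  constructor
  · rintro ⟨w, h0, hJ, h1, rfl⟩ j
    rw [gap_sum_smul_vertex π h1]
    exact ⟨h0 j, hJ j⟩
  · exact fun h => ⟨gap π x, fun j => (h j).1, fun j => (h j).2, sum_gap π x,
      (sum_gap_smul_vertex π x).symm⟩

lemma openSimplex_vertex : openSimplex (vertex π) = chamber π := by
  rw [openSimplex, halfOpenSimplex_vertex]
  ext x
  exact forall_congr' fun j => ⟨fun h => h.2 trivial, fun h => ⟨h.le, fun _ => h⟩⟩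

lemma affineIndependent_vertex : AffineIndependent ℝ (vertex π) := by
  rw [affineIndependent_iff_of_fintype]
  intro w hw hv j
  rw [Finset.univ.weightedVSub_eq_linear_combination hw] at hv
  have key : ∀ k ≤ n + 1, ∑ j : Fin (n + 1), (if (j : ℕ) < k then w j else 0) = 0 := by
    intro k hk
    rcases k with _ | k
    · simp
    rcases Nat.lt_or_ge k n with hkn | hkn
    · have := congrFun hv (π ⟨k, hkn⟩)
      simpa [vertex, Nat.lt_succ_iff] using this
    · obtain rfl : k = n := by omega
      simpa only [Fin.is_lt, if_true] using hw
  rw [← sum_ite_lt_succ_sub w j, key _ (by omega), key _ (by omega), sub_zero]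

/-- On the cube, the comparisons between the terms of `0, x (π 0), …, x (π (n - 1)), 1` depend
only on the order type of `x`. -/
lemma sortedValue_le_congr {x y : Fin n → ℝ} (hx : x ∈ openCube n) (hy : y ∈ openCube n)
    (h : ∀ i j, x i ≤ x j ↔ y i ≤ y j) (k l : ℕ) :
    sortedValue π x k ≤ sortedValue π x l ↔ sortedValue π y k ≤ sortedValue π y l := by
  unfold sortedValue
  split_ifs
  all_goals first
    | exact h _ _
    | exact Iff.rfl
    | exact iff_of_true (hx _).1.le (hy _).1.le
    | exact iff_of_true (hx _).2.le (hy _).2.le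
    | exact iff_of_false (hx _).1.not_ge (hy _).1.not_ge
    | exact iff_of_false (hx _).2.not_ge (hy _).2.not_ge

lemma gap_nonneg_congr {x y : Fin n → ℝ} (hx : x ∈ openCube n) (hy : y ∈ openCube n)
    (h : ∀ i j, x i ≤ x j ↔ y i ≤ y j) (j : Fin (n + 1)) : 0 ≤ gap π x j ↔ 0 ≤ gap π y j := by
  simp only [gap, sub_nonneg]
  exact sortedValue_le_congr π hx hy h _ _

lemma gap_pos_congr {x y : Fin n → ℝ} (hx : x ∈ openCube n) (hy : y ∈ openCube n)
    (h : ∀ i j, x i ≤ x j ↔ y i ≤ y j) (j : Fin (n + 1)) : 0 < gap π x j ↔ 0 < gap π y j := by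
  simp only [gap, sub_pos]
  exact lt_iff_lt_of_le_iff_le (sortedValue_le_congr π hx hy h _ _)

lemma halfOpenChamber_congr {q x y : Fin n → ℝ} (hx : x ∈ openCube n) (hy : y ∈ openCube n)
    (h : ∀ i j, x i ≤ x j ↔ y i ≤ y j) : x ∈ halfOpenChamber π q ↔ y ∈ halfOpenChamber π q :=
  forall_congr' fun j => and_congr (gap_nonneg_congr π hx hy h j)
    (imp_congr_right fun _ => gap_pos_congr π hx hy h j)

variable {π}

lemma sortedValue_lt {x : Fin n → ℝ} (hx : x ∈ chamber π) {k l : ℕ} (hkl : k < l)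
    (hl : l ≤ n + 1) : sortedValue π x k < sortedValue π x l := by
  have hstep : ∀ j < n + 1, sortedValue π x j < sortedValue π x (j + 1) := fun j hj =>
    sub_pos.1 (hx ⟨j, hj⟩)
  induction l, hkl using Nat.le_induction with
  | base => exact hstep k hl
  | succ l _ ih => exact (ih (by omega)).trans (hstep l (by omega))

lemma mem_chamber_iff {x : Fin n → ℝ} :
    x ∈ chamber π ↔ x ∈ openCube n ∧ StrictMono (x ∘ π) := by
  constructor
  · refine fun hx => ⟨fun i => ?_, fun i j hij => ?_⟩
    · obtain ⟨i, rfl⟩ := π.surjective i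
      rw [← sortedValue_succ π x]
      constructor
      · rw [← sortedValue_zero π x]
        exact sortedValue_lt hx (by omega) (by omega)
      · rw [← sortedValue_last π x]
        exact sortedValue_lt hx (by omega) le_rfl
    · simp only [Function.comp_apply, ← sortedValue_succ π x]
      exact sortedValue_lt hx (by omega) (by omega)
  · rintro ⟨hc, hm⟩ ⟨j, hj⟩
    rw [gap, sub_pos]
    simp only [sortedValue]
    split_ifs
    all_goals first
      | contradiction
      | omega
      | exact (hc _).1
      | exact (hc _).2
      | exact one_pos
      | exact hm (Fin.mk_lt_mk.2 (by omega))

lemma chamber_le_iff_le {x : Fin n → ℝ} (hx : x ∈ chamber π) (i j : Fin n) :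
    x i ≤ x j ↔ π.symm i ≤ π.symm j := by
  rw [← (mem_chamber_iff.1 hx).2.le_iff_le]
  simp

lemma chamber_eq_of_mem {π' : Equiv.Perm (Fin n)} {x : Fin n → ℝ} (hx : x ∈ chamber π)
    (hx' : x ∈ chamber π') : π = π' := by
  have h := (mem_chamber_iff.1 hx).2
  have h' := (mem_chamber_iff.1 hx').2
  rw [Tuple.eq_sort_iff.2 ⟨h.monotone, fun i j hij he => absurd he (h hij).ne⟩,
    Tuple.eq_sort_iff.2 ⟨h'.monotone, fun i j hij he => absurd he (h' hij).ne⟩]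

lemma exists_mem_chamber {x : Fin n → ℝ} (hx : x ∈ openCube n) (hinj : Function.Injective x) :
    ∃ π, x ∈ chamber π :=
  ⟨Tuple.sort x, mem_chamber_iff.2 ⟨hx, (Tuple.monotone_sort x).strictMono_of_injective
    (hinj.comp (Tuple.sort x).injective)⟩⟩

lemma chamber_nonempty (π : Equiv.Perm (Fin n)) : (chamber π).Nonempty := by
  -- The barycenter: all barycentric coordinates are equal.
  have hpos : (0 : ℝ) < n + 1 := by positivity
  refine ⟨∑ j, ((n : ℝ) + 1)⁻¹ • vertex π j, fun j => ?_⟩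
  rw [gap_sum_smul_vertex π (by simp [hpos.ne'])]
  exact inv_pos.2 hpos

/-- The chamber of `π` is the face of the ordered set partition into singletons listed by `π`. -/
lemma exists_face_eq_chamber (π : Equiv.Perm (Fin n)) :
    ∃ Φ : OrderedSetPartition n, Φ.face = chamber π := by
  refine ⟨⟨n, fun k => {π k}, fun k => Finset.singleton_nonempty _, fun k l hkl => ?_,
    fun i => ⟨π.symm i, by simp⟩⟩, ?_⟩
  · simpa using hkl
  · ext x
    rw [mem_chamber_iff]
    simp [OrderedSetPartition.face, OrderedSetPartition.IsOrderTypeOf, StrictMono]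

lemma chamber_mem_allow {S : Problem n} (h : ∀ x ∈ chamber π, S.Holds x) :
    chamber π ∈ allow S := by
  obtain ⟨Φ, hΦ⟩ := exists_face_eq_chamber π
  obtain ⟨x, hx⟩ := chamber_nonempty π
  have hx' : x ∈ Φ.face := hΦ ▸ hx
  exact ⟨Φ, (Φ.solves_iff hx'.2 S).2 (h x hx), hΦ.symm⟩

/-- A chamber that meets a cell lies in it. -/
lemma chamber_subset_cellPolytope {c : List (Ineq n)} {x : Fin n → ℝ} (hx : x ∈ chamber π)
    (hxc : x ∈ cellPolytope c) : chamber π ⊆ cellPolytope c := fun y hy =>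
  ⟨(mem_chamber_iff.1 hy).1, fun I hI => (I.holds_congr fun i j => by
    rw [chamber_le_iff_le hx, chamber_le_iff_le hy]).1 (hxc.2 I hI)⟩

end Chambers

/-! ### Moving away from a generic point -/

section Push

variable {n : ℕ} {π : Equiv.Perm (Fin n)} {q x : Fin n → ℝ}

lemma tendsto_push (q x : Fin n → ℝ) :
    Tendsto (fun ε : ℝ => x + ε • (x - q)) (𝓝[>] 0) (𝓝 x) := by
  have : Continuous fun ε : ℝ => x + ε • (x - q) := by fun_prop
  simpa using (this.tendsto 0).mono_left nhdsWithin_le_nhds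

lemma isOpen_openCube (n : ℕ) : IsOpen (openCube n) := by
  simp only [openCube, Set.ofPred_forall]
  exact isOpen_iInter_of_finite fun i =>
    (isOpen_lt continuous_const (continuous_apply i)).inter
      (isOpen_lt (continuous_apply i) continuous_const)

lemma gap_push (π : Equiv.Perm (Fin n)) (q x : Fin n → ℝ) (ε : ℝ) (j : Fin (n + 1)) :
    gap π (x + ε • (x - q)) j = gap π x j + ε * (gap π x j - gap π q j) := by
  have key : ∀ k, sortedValue π (x + ε • (x - q)) k =
      sortedValue π x k + ε * (sortedValue π x k - sortedValue π q k) := by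
    intro k
    unfold sortedValue
    split_ifs <;> simp
  simp only [gap, key]
  ring

/-- An affine function with value `a` at `x` and `b` at `q` is positive after a small step from `x`
away from `q` if it is positive at `x`, or zero at `x` and negative at `q`. -/
lemma eventually_push_pos {a b : ℝ} (ha : 0 ≤ a) (hb : a = 0 → b < 0) :
    ∀ᶠ ε : ℝ in 𝓝[>] 0, 0 < a + ε * (a - b) := by
  rcases ha.eq_or_lt with rfl | ha
  · filter_upwards [self_mem_nhdsWithin] with ε hε
    have := mul_pos (Set.mem_Ioi.1 hε) (neg_pos.2 (hb rfl))
    linarith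
  · have : Continuous fun ε : ℝ => a + ε * (a - b) := by fun_prop
    exact ((this.tendsto 0).mono_left nhdsWithin_le_nhds).eventually_const_lt (by simpa using ha)

/-- The removed facets are chosen such that the half-open chamber consists of the points from
which a small step away from `q` leads into the open chamber. -/
lemma eventually_push_mem_chamber (hq : ∀ j, gap π q j ≠ 0) (hx : x ∈ halfOpenChamber π q) :
    ∀ᶠ ε : ℝ in 𝓝[>] 0, x + ε • (x - q) ∈ chamber π := by
  simp only [chamber, Set.mem_ofPred_eq, gap_push]
  refine eventually_all.2 fun j => eventually_push_pos (hx j).1 fun h0 => ?_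
  exact lt_of_le_of_ne (not_lt.1 fun h => ((hx j).2 h).ne' h0) (hq j)

lemma mem_halfOpenChamber_of_frequently
    (h : ∃ᶠ ε : ℝ in 𝓝[>] 0, x + ε • (x - q) ∈ chamber π) : x ∈ halfOpenChamber π q := by
  intro j
  have h' : ∃ᶠ ε : ℝ in 𝓝[>] 0, 0 < ε ∧ 0 < gap π x j + ε * (gap π x j - gap π q j) := by
    refine (h.and_eventually self_mem_nhdsWithin).mono fun ε hε => ⟨hε.2, ?_⟩
    rw [← gap_push]
    exact hε.1 j
  have h0 : 0 ≤ gap π x j := by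
    by_contra hneg
    have := eventually_push_pos (a := -gap π x j) (b := -gap π q j) (by linarith)
      (fun h => by linarith)
    obtain ⟨ε, ⟨-, h1⟩, h2⟩ := (h'.and_eventually this).exists
    linarith
  refine ⟨h0, fun hqj => lt_of_le_of_ne h0 fun he => ?_⟩
  obtain ⟨ε, hε, h1⟩ := h'.exists
  rw [← he] at h1
  nlinarith [mul_pos hε hqj]

lemma gap_ne_zero (π : Equiv.Perm (Fin n)) (hq : q ∈ openCube n) (hinj : Function.Injective q)
    (j : Fin (n + 1)) : gap π q j ≠ 0 := by
  obtain ⟨j, hj⟩ := j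
  rw [gap, sub_ne_zero]
  simp only [sortedValue]
  split_ifs
  all_goals first
    | contradiction
    | omega
    | exact (hq _).1.ne'
    | exact (hq _).2.ne'
    | exact one_ne_zero
    | exact fun h => by
        have := congrArg Fin.val (π.injective (hinj h))
        simp only at this
        omega

lemma eventually_push_injective (x : Fin n → ℝ) (hinj : Function.Injective q) :
    ∀ᶠ ε : ℝ in 𝓝[>] 0, Function.Injective (x + ε • (x - q)) := by
  have key : ∀ i j, ∀ᶠ ε : ℝ in 𝓝[>] 0, i ≠ j → (x + ε • (x - q)) i ≠ (x + ε • (x - q)) j := by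
    intro i j
    by_cases hij : i = j
    · simp [hij]
    by_cases hx : x i = x j
    · filter_upwards [self_mem_nhdsWithin] with ε hε _ he
      simp only [Pi.add_apply, Pi.smul_apply, Pi.sub_apply, smul_eq_mul, hx] at he
      have := mul_left_cancel₀ (ne_of_gt hε) (add_left_cancel he)
      exact hij (hinj (by linarith))
    · have h1 := (continuous_apply i).tendsto x |>.comp (tendsto_push q x)
      have h2 := (continuous_apply j).tendsto x |>.comp (tendsto_push q x)
      filter_upwards [(h1.sub h2).eventually_ne (sub_ne_zero.2 hx)] with ε hε _
      exact sub_ne_zero.1 hε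
  filter_upwards [eventually_all.2 fun i => eventually_all.2 (key i)] with ε hε i j he
  by_contra hij
  exact hε i j hij he

/-- The half-open chambers cover the cube. -/
lemma exists_mem_halfOpenChamber (hinj : Function.Injective q) (hx : x ∈ openCube n) :
    ∃ π, x ∈ halfOpenChamber π q := by
  by_contra! h
  have h1 : ∀ᶠ ε : ℝ in 𝓝[>] 0, ∀ π, x + ε • (x - q) ∉ chamber π :=
    eventually_all.2 fun π => not_frequently.1 fun hf => h π (mem_halfOpenChamber_of_frequently hf)
  have h2 := (tendsto_push q x).eventually_mem ((isOpen_openCube n).mem_nhds hx)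
  obtain ⟨ε, h1, h2, h3⟩ := (h1.and (h2.and (eventually_push_injective x hinj))).exists
  obtain ⟨π, hπ⟩ := exists_mem_chamber h2 h3
  exact h1 π hπ

/-- The half-open chambers are pairwise disjoint. -/
lemma halfOpenChamber_eq_of_mem {π' : Equiv.Perm (Fin n)} (hq : q ∈ openCube n)
    (hinj : Function.Injective q) (hx : x ∈ halfOpenChamber π q)
    (hx' : x ∈ halfOpenChamber π' q) : π = π' := by
  obtain ⟨ε, h, h'⟩ := ((eventually_push_mem_chamber (gap_ne_zero π hq hinj) hx).and
    (eventually_push_mem_chamber (gap_ne_zero π' hq hinj) hx')).exists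
  exact chamber_eq_of_mem h h'

lemma halfOpenChamber_subset_closure (hq : ∀ j, gap π q j ≠ 0) :
    halfOpenChamber π q ⊆ closure (chamber π) := fun x hx =>
  mem_closure_of_tendsto (tendsto_push q x) (eventually_push_mem_chamber hq hx)

lemma exists_injective_mem_of_isOpen {U : Set (Fin n → ℝ)} (hU : IsOpen U) (hx : x ∈ U) :
    ∃ q ∈ U, Function.Injective q := by
  -- Any step from `x` away from a point with distinct coordinates will do if it is small enough.
  have hinj : Function.Injective fun i : Fin n => (i : ℝ) := fun i j h => by
    simpa [Fin.ext_iff] using h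
  obtain ⟨ε, h1, h2⟩ := (((tendsto_push _ x).eventually_mem (hU.mem_nhds hx)).and
    (eventually_push_injective x hinj)).exists
  exact ⟨_, h1, h2⟩

end Push

/-! ### Almost open sets and steps away from a suitable point -/

/-- The slack of a linear inequality at a point: it is non-negative at the solutions of a weak
inequality and positive at the solutions of a strict one. -/
def LinIneq.slack {n : ℕ} (I : LinIneq n) (x : Fin n → ℝ) : ℝ :=
  I.bound - ∑ i, I.coeff i * x i

section AlmostOpen

variable {n : ℕ} {Q : Set (Fin n → ℝ)}

lemma LinIneq.holds_iff_of_weak {I : LinIneq n} (h : I.weak) (x : Fin n → ℝ) :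
    I.Holds x ↔ 0 ≤ I.slack x := by
  simp [LinIneq.Holds, LinIneq.slack, h]

lemma LinIneq.holds_iff_of_not_weak {I : LinIneq n} (h : ¬ I.weak) (x : Fin n → ℝ) :
    I.Holds x ↔ 0 < I.slack x := by
  simp [LinIneq.Holds, LinIneq.slack, h]

lemma LinIneq.continuous_slack (I : LinIneq n) : Continuous I.slack := by
  unfold LinIneq.slack
  fun_prop

lemma LinIneq.slack_add_smul (I : LinIneq n) (x v : Fin n → ℝ) (ε : ℝ) :
    I.slack (x + ε • v) = I.slack x - ε * ∑ i, I.coeff i * v i := by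
  simp only [LinIneq.slack, Pi.add_apply, Pi.smul_apply, smul_eq_mul, mul_add,
    Finset.sum_add_distrib, Finset.mul_sum]
  rw [sub_sub]
  congr 2
  exact Finset.sum_congr rfl fun i _ => by ring

lemma LinIneq.slack_push (I : LinIneq n) (q x : Fin n → ℝ) (ε : ℝ) :
    I.slack (x + ε • (x - q)) = I.slack x + ε * (I.slack x - I.slack q) := by
  rw [I.slack_add_smul]
  simp only [LinIneq.slack, Pi.sub_apply, mul_sub, Finset.sum_sub_distrib]
  ring

/-- If all coefficients were zero, then the face would be empty or the whole closure of `Q`, whose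
dimension is too large. -/
lemma LinIneq.IsFacetDefining.coeff_ne_zero {I : LinIneq n} (h : I.IsFacetDefining Q) :
    I.coeff ≠ 0 := by
  intro h0
  obtain ⟨x, -, hx⟩ := h.2.1
  have hb : I.bound = 0 := by simpa [h0] using hx.symm
  have hface : I.faceOf Q = closure Q := by
    ext y
    simp [LinIneq.faceOf, h0, hb]
  have h1 := h.2.2
  rw [hface] at h1
  have h2 := Submodule.finrank_mono (vectorSpan_mono ℝ (subset_closure (s := Q)))
  omega

lemma IsAlmostOpen.nonempty (h : IsAlmostOpen Q) : Q.Nonempty := by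
  obtain ⟨k, I, hQ, hI, -⟩ := h
  rcases k with _ | k
  · exact ⟨0, (hQ 0).2 fun j => j.elim0⟩
  · obtain ⟨x, hx, -⟩ := (hI 0).2.1
    exact closure_nonempty_iff.1 ⟨x, hx⟩

/-- For an almost open subset `Q` of the cube there is a point `q` with distinct coordinates such
that small steps away from `q` neither leave nor enter `Q`. The point satisfies the strict
inequalities of `Q`; if `Q` contains points on the hyperplane of its weak inequality, then `q` lies
beyond this hyperplane. -/
lemma IsAlmostOpen.exists_generic_point (h : IsAlmostOpen Q) (hc : Q ⊆ openCube n) :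
    ∃ q ∈ openCube n, Function.Injective q ∧ ∀ x,
      (x ∈ Q → ∀ᶠ ε : ℝ in 𝓝[>] 0, x + ε • (x - q) ∈ Q) ∧
      (x ∉ Q → ∀ᶠ ε : ℝ in 𝓝[>] 0, x + ε • (x - q) ∉ Q) := by
  obtain ⟨z, hz⟩ := h.nonempty
  obtain ⟨k, I, hQ, hI, hweak⟩ := h
  let V : Set (Fin n → ℝ) := openCube n ∩ ⋂ j, {y | ¬ (I j).weak → 0 < (I j).slack y}
  have hV : IsOpen V := by
    refine (isOpen_openCube n).inter (isOpen_iInter_of_finite fun j => ?_)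
    by_cases hj : (I j).weak
    · simp [hj]
    · simpa [hj] using isOpen_lt continuous_const (I j).continuous_slack
  have hQV : Q ⊆ V := fun y hy => ⟨hc hy, Set.mem_iInter.2 fun j hj =>
    (LinIneq.holds_iff_of_not_weak hj y).1 ((hQ y).1 hy j)⟩
  -- The point has to lie beyond the weak hyperplane only if some point of `Q` lies on it.
  obtain ⟨q, ⟨hqV, hinj⟩, hqw⟩ : ∃ q, (q ∈ V ∧ Function.Injective q) ∧
      ∀ j, (I j).weak → ∀ y ∈ Q, (I j).slack y = 0 → (I j).slack q < 0 := by
    by_cases htight : ∃ j, (I j).weak ∧ ∃ y ∈ Q, (I j).slack y = 0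
    · obtain ⟨j, hj, y, hy, hy0⟩ := htight
      have hcont : Continuous fun t : ℝ => y + t • (I j).coeff := by fun_prop
      have h1 : ∀ᶠ t : ℝ in 𝓝[>] 0, y + t • (I j).coeff ∈ V :=
        ((hcont.tendsto 0).mono_left nhdsWithin_le_nhds).eventually_mem
          (hV.mem_nhds (by simpa using hQV hy))
      obtain ⟨t, ht, ht0⟩ := (h1.and self_mem_nhdsWithin).exists
      have hsq : 0 < ∑ i, (I j).coeff i * (I j).coeff i := by
        obtain ⟨i, hi⟩ := Function.ne_iff.1 (hI j).coeff_ne_zero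
        exact Finset.sum_pos' (fun i _ => mul_self_nonneg _)
          ⟨i, Finset.mem_univ i, mul_self_pos.2 hi⟩
      have hneg : (I j).slack (y + t • (I j).coeff) < 0 := by
        rw [(I j).slack_add_smul, hy0]
        have := mul_pos (Set.mem_Ioi.1 ht0) hsq
        linarith
      obtain ⟨q, hq, hinj⟩ := exists_injective_mem_of_isOpen
        (hV.inter (isOpen_lt (I j).continuous_slack continuous_const)) ⟨ht, hneg⟩
      exact ⟨q, ⟨hq.1, hinj⟩, fun l hl _ _ _ => hweak j l hj hl ▸ hq.2⟩
    · obtain ⟨q, hq, hinj⟩ := exists_injective_mem_of_isOpen hV (hQV hz)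
      exact ⟨q, ⟨hq, hinj⟩, fun j hj y hy hy0 => absurd ⟨j, hj, y, hy, hy0⟩ htight⟩
  have hqs : ∀ j, ¬ (I j).weak → 0 < (I j).slack q := fun j => Set.mem_iInter.1 hqV.2 j
  refine ⟨q, hqV.1, hinj, fun x => ⟨fun hx => ?_, fun hx => ?_⟩⟩
  · simp only [hQ]
    refine eventually_all.2 fun j => ?_
    have hxj := (hQ x).1 hx j
    by_cases hj : (I j).weak
    · filter_upwards [eventually_push_pos ((LinIneq.holds_iff_of_weak hj x).1 hxj)
        (hqw j hj x hx)] with ε hε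
      rw [LinIneq.holds_iff_of_weak hj, LinIneq.slack_push]
      exact hε.le
    · have hpos := (LinIneq.holds_iff_of_not_weak hj x).1 hxj
      filter_upwards [eventually_push_pos hpos.le (fun h => absurd h hpos.ne')] with ε hε
      rw [LinIneq.holds_iff_of_not_weak hj, LinIneq.slack_push]
      exact hε
  · simp only [hQ, not_forall] at hx ⊢
    obtain ⟨j, hj⟩ := hx
    have hneg : ∀ᶠ ε : ℝ in 𝓝[>] 0,
        0 < -(I j).slack x + ε * (-(I j).slack x - -(I j).slack q) := by
      by_cases hw : (I j).weak
      · rw [LinIneq.holds_iff_of_weak hw, not_le] at hj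
        exact eventually_push_pos (by linarith) fun h => by linarith
      · rw [LinIneq.holds_iff_of_not_weak hw, not_lt] at hj
        exact eventually_push_pos (by linarith) fun _ => by linarith [hqs j hw]
    filter_upwards [hneg] with ε hε
    refine ⟨j, fun hh => ?_⟩
    have h0 : 0 ≤ (I j).slack (x + ε • (x - q)) := by
      by_cases hw : (I j).weak
      · exact (LinIneq.holds_iff_of_weak hw _).1 hh
      · exact ((LinIneq.holds_iff_of_not_weak hw _).1 hh).le
    rw [LinIneq.slack_push] at h0
    linarith

/-- The half-open chambers with respect to a suitable point whose open chambers lie in an almost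
open cell partition this cell. -/
lemma IsAlmostOpen.exists_partition {c : List (Ineq n)} (h : IsAlmostOpen (cellPolytope c)) :
    ∃ q ∈ openCube n, Function.Injective q ∧ ∀ x, x ∈ cellPolytope c ↔
      ∃ π, chamber π ⊆ cellPolytope c ∧ x ∈ halfOpenChamber π q := by
  obtain ⟨q, hq, hinj, hpush⟩ := h.exists_generic_point fun x hx => hx.1
  refine ⟨q, hq, hinj, fun x => ⟨fun hx => ?_, ?_⟩⟩
  · obtain ⟨π, hπ⟩ := exists_mem_halfOpenChamber hinj hx.1
    obtain ⟨ε, h1, h2⟩ := ((eventually_push_mem_chamber (gap_ne_zero π hq hinj) hπ).and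
      ((hpush x).1 hx)).exists
    exact ⟨π, chamber_subset_cellPolytope h1 h2, hπ⟩
  · rintro ⟨π, hsub, hπ⟩
    by_contra hx
    obtain ⟨ε, h1, h2⟩ := ((eventually_push_mem_chamber (gap_ne_zero π hq hinj) hπ).and
      ((hpush x).2 hx)).exists
    exact h2 (hsub h1)

end AlmostOpen

/-! ### Partitionability of disjoint unions of almost open cells -/

/-- The cells are given as a set of sets, so that repetitions in a list of cells do not matter. -/
lemma isPartitionable_allow {n : ℕ} (S : Problem n) (𝒬 : Set (Set (Fin n → ℝ)))
    (hcell : ∀ Q ∈ 𝒬, ∃ c : List (Ineq n), Q = cellPolytope c) (hopen : ∀ Q ∈ 𝒬, IsAlmostOpen Q)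
    (hdisj : 𝒬.PairwiseDisjoint id) (hunion : ⋃₀ 𝒬 = {x | x ∈ openCube n ∧ S.Holds x}) :
    IsPartitionable n (allow S) := by
  have hex : ∀ Q : 𝒬, ∃ q ∈ openCube n, Function.Injective q ∧ ∀ x, x ∈ Q.1 ↔
      ∃ π, chamber π ⊆ Q.1 ∧ x ∈ halfOpenChamber π q := by
    rintro ⟨Q, hQ⟩
    obtain ⟨c, rfl⟩ := hcell Q hQ
    exact (hopen _ hQ).exists_partition
  choose q hq hinj hpart using hex
  have hallow : ∀ (Q : 𝒬) (π), chamber π ⊆ Q.1 → chamber π ∈ allow S := fun Q π hπ =>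
    chamber_mem_allow fun x hx => by
      have : x ∈ ⋃₀ 𝒬 := ⟨Q.1, Q.2, hπ hx⟩
      rw [hunion] at this
      exact this.2
  constructor
  · intro σ hσ hmax
    obtain ⟨Φ, hΦ, rfl⟩ := id hσ
    obtain ⟨x, hx⟩ := Φ.face_nonempty
    have hxu : x ∈ ⋃₀ 𝒬 := by
      rw [hunion, ← sUnion_allow]
      exact ⟨_, hσ, hx⟩
    obtain ⟨Q, hQ, hxQ⟩ := hxu
    obtain ⟨π, hπ, hxπ⟩ := (hpart ⟨Q, hQ⟩ x).1 hxQ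
    refine ⟨vertex π, affineIndependent_vertex π, ?_⟩
    rw [openSimplex_vertex]
    -- The face lies in the half-open chamber that contains one of its points.
    refine (hmax _ (hallow _ π hπ) fun y hy => ?_).symm
    exact halfOpenChamber_subset_closure (gap_ne_zero π (hq _) (hinj _))
      ((halfOpenChamber_congr π hx.1 hy.1 (hx.2.le_iff_le hy.2)).1 hxπ)
  · refine ⟨{H | ∃ (Q : 𝒬) (π : Equiv.Perm (Fin n)), chamber π ⊆ Q.1 ∧
      H = halfOpenChamber π (q Q)}, ?_, ?_, ?_⟩
    · rintro _ ⟨Q, π, hπ, rfl⟩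
      refine ⟨vertex π, {j | 0 < gap π (q Q) j}, affineIndependent_vertex π, ?_, ?_⟩
      · rw [openSimplex_vertex]
        exact hallow Q π hπ
      · rw [halfOpenSimplex_vertex]
        rfl
    · rintro _ ⟨Q, π, hπ, rfl⟩ _ ⟨Q', π', hπ', rfl⟩ hne
      refine Set.disjoint_left.2 fun x hx hx' => hne ?_
      simp only [id] at hx hx'
      have hQQ' : Q = Q' := by
        by_contra hQ
        exact Set.disjoint_left.1 (hdisj Q.2 Q'.2 fun h => hQ (Subtype.ext h))
          ((hpart Q x).2 ⟨π, hπ, hx⟩) ((hpart Q' x).2 ⟨π', hπ', hx'⟩)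
      subst hQQ'
      rw [halfOpenChamber_eq_of_mem (hq Q) (hinj Q) hx hx']
    · rw [sUnion_allow, ← hunion]
      ext x
      constructor
      · rintro ⟨_, ⟨Q, π, hπ, rfl⟩, hx⟩
        exact ⟨Q.1, Q.2, (hpart Q x).2 ⟨π, hπ, hx⟩⟩
      · rintro ⟨Q, hQ, hx⟩
        obtain ⟨π, hπ, hxπ⟩ := (hpart ⟨Q, hQ⟩ x).1 hx
        exact ⟨_, ⟨⟨Q, hQ⟩, π, hπ, rfl⟩, hxπ⟩

/-! ### Cells of decision trees -/

lemma DecisionTree.holds_toProblem_iff {n : ℕ} (S : DecisionTree n) (x : Fin n → ℝ) :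
    S.toProblem.Holds x ↔ ∃ c ∈ S.cells, ∀ I ∈ c, I.Holds x := by
  induction S with
  | leaf c =>
    simp [DecisionTree.toProblem, DecisionTree.cells, Problem.holds_bigConj, Ineq.holds_toProblem]
  | cond φ t f iht ihf =>
    have h : (DecisionTree.cond φ t f).toProblem.Holds x ↔
        (φ.toProblem.Holds x ∧ t.toProblem.Holds x) ∨
          (¬ φ.toProblem.Holds x ∧ f.toProblem.Holds x) := Iff.rfl
    rw [h, iht, ihf, Ineq.holds_toProblem, ← Ineq.holds_negate]
    simp only [DecisionTree.cells, List.mem_append, List.mem_map, or_and_right, exists_or,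
      exists_exists_and_eq_and, List.forall_mem_cons]
    refine or_congr ?_ ?_ <;>
      exact ⟨fun ⟨h, c, hc, hx⟩ => ⟨c, hc, h, hx⟩, fun ⟨c, hc, h, hx⟩ => ⟨h, c, hc, hx⟩⟩

/-- Two cells with a common point coincide. -/
lemma DecisionTree.cellPolytope_eq {n : ℕ} (S : DecisionTree n) {c c' : List (Ineq n)}
    (hc : c ∈ S.cells) (hc' : c' ∈ S.cells) {x : Fin n → ℝ} (hx : x ∈ cellPolytope c)
    (hx' : x ∈ cellPolytope c') : cellPolytope c = cellPolytope c' := by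
  have hcons : ∀ (φ : Ineq n) (c : List (Ineq n)),
      cellPolytope (φ :: c) = cellPolytope c ∩ {y | φ.Holds y} := fun φ c => by
    ext y
    simp only [cellPolytope, List.forall_mem_cons, Set.mem_inter_iff, Set.mem_ofPred_eq]
    tauto
  induction S generalizing c c' with
  | leaf d =>
    simp only [DecisionTree.cells, List.mem_singleton] at hc hc'
    rw [hc, hc']
  | cond φ t f iht ihf =>
    simp only [DecisionTree.cells, List.mem_append, List.mem_map] at hc hc'
    rcases hc with ⟨d, hd, rfl⟩ | ⟨d, hd, rfl⟩ <;>
      rcases hc' with ⟨d', hd', rfl⟩ | ⟨d', hd', rfl⟩ <;>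
      rw [hcons] at hx hx' ⊢ <;> rw [hcons]
    · rw [iht hd hd' hx.1 hx'.1]
    · exact absurd hx.2 ((φ.holds_negate x).1 hx'.2)
    · exact absurd hx'.2 ((φ.holds_negate x).1 hx.2)
    · rw [ihf hd hd' hx.1 hx'.1]

/-- The formula `T` only has to be equivalent to the disjunction of the decision trees, so that a
single decision tree is covered as well. -/
theorem isPartitionable_allow_bigDisj {n m : ℕ} (S : Fin m → DecisionTree n)
    (hopen : ∀ i, (S i).AllCellsAlmostOpen)
    (hdisj : ∀ x : Fin n → ℝ, ∀ i j, (S i).toProblem.Holds x → (S j).toProblem.Holds x → i = j)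
    (T : Problem n) (hT : ∀ x : Fin n → ℝ, T.Holds x ↔ ∃ i, (S i).toProblem.Holds x) :
    IsPartitionable n (allow T) := by
  refine isPartitionable_allow T {Q | ∃ i, ∃ c ∈ (S i).cells, Q = cellPolytope c} ?_ ?_ ?_ ?_
  · rintro _ ⟨i, c, -, rfl⟩
    exact ⟨c, rfl⟩
  · rintro _ ⟨i, c, hc, rfl⟩
    exact hopen i c hc
  · rintro _ ⟨i, c, hc, rfl⟩ _ ⟨j, d, hd, rfl⟩ hne
    refine Set.disjoint_left.2 fun x hx hx' => hne ?_
    obtain rfl : i = j := hdisj x i j (((S i).holds_toProblem_iff x).2 ⟨c, hc, hx.2⟩)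
      (((S j).holds_toProblem_iff x).2 ⟨d, hd, hx'.2⟩)
    exact (S i).cellPolytope_eq hc hd hx hx'
  · ext x
    simp only [Set.mem_sUnion, Set.mem_ofPred_eq, hT, DecisionTree.holds_toProblem_iff]
    constructor
    · rintro ⟨_, ⟨i, c, hc, rfl⟩, hx⟩
      exact ⟨hx.1, i, c, hc, hx.2⟩
    · rintro ⟨hx, i, c, hc, hxc⟩
      exact ⟨_, ⟨i, c, hc, rfl⟩, hx, hxc⟩

end Scheduling

theorem mainTheorem4 (n : ℕ) :
    (∀ S : Scheduling.DecisionTree n, S.AllCellsAlmostOpen →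
      Scheduling.IsPartitionable n (Scheduling.allow S.toProblem)) ∧
    (∀ (m : ℕ) (S : Fin m → Scheduling.DecisionTree n),
      (∀ i, (S i).AllCellsAlmostOpen) →
      (∀ x : Fin n → ℝ, ∀ i j, (S i).toProblem.Holds x → (S j).toProblem.Holds x → i = j) →
      Scheduling.IsPartitionable n
        (Scheduling.allow (Scheduling.Problem.bigDisj (List.ofFn fun i => (S i).toProblem)))) := by
  refine ⟨fun S hS => ?_, fun m S hS hdisj => ?_⟩
  · exact Scheduling.isPartitionable_allow_bigDisj (fun _ : Fin 1 => S) (fun _ => hS)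
      (fun _ i j _ _ => Subsingleton.elim i j) _ fun x => by simp
  · refine Scheduling.isPartitionable_allow_bigDisj S hS hdisj _ fun x => ?_
    simp [Scheduling.Problem.holds_bigDisj, List.mem_ofFn]
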